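/- Let $M\ge 0$ be an integer, $G,G'\ge 1$ and $\kappa,\kappa'\in[0,1]$. Let $\mathcal L_\kappa$ denote the single-mode pure-loss channel of transmittance $\kappa$ (the mode is mixed with a vacuum environment mode on a beam splitter of transmittance $\kappa$, and the environment is traced out), and let $\mathcal A_G$ denote the single-mode quantum-limited amplifier of gain $G$ (the mode undergoes two-mode squeezing of gain $G$ with a vacuum environment mode, and the environment is traced out). Put $$\mathcal C=(\mathcal A_G\circ\mathcal L_\kappa)^{\otimes M},\qquad \mathcal C'=(\mathcal A_{G'}\circ\mathcal L_{\kappa'})^{\otimes M},$$ acting on a system $S$ of $M$ bosonic modes with Fock basis $|\mathbf n\rangle_S$, $\mathbf n=(n_1,\dots,n_M)\in\mathbb N^M$. Let $I$ be a system with Hilbert space $\mathcal H_I$, let $\{|\chi_{\mathbf n}\rangle_I\}_{\mathbf n\in\mathbb N^M}$ be an orthonormal family in $\mathcal H_I$, let $\{p_{\mathbf n}\}$ be a probability distribution on $\mathbb N^M$, and let $$|\psi\rangle_{IS}=\sum_{\mathbf n}\sqrt{p_{\mathbf n}}\,|\chi_{\mathbf n}\rangle_I|\mathbf n\rangle_S,\qquad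 \Psi=|\psi\rangle\langle\psi|_{IS}$$ be the corresponding number-diagonal-signal (NDS) probe. Let $p_n=\sum_{\mathbf n:\,n_1+\cdots+n_M=n}p_{\mathbf n}$ be the distribution of the total photon number in $S$. For the output states $\rho=(\mathrm{id}_I\otimes\mathcal C)(\Psi)$ and $\rho'=(\mathrm{id}_I\otimes\mathcal C')(\Psi)$, the fidelity $F(\rho,\rho')=\operatorname{Tr}\sqrt{\sqrt{\rho}\,\rho'\sqrt{\rho}}$ satisfies $$F(\rho,\rho')\;\ge\;\nu^M\sum_{n=0}^\infty p_n\left[\nu\sqrt{\kappa\kappa'}+\sqrt{(1-\kappa)(1-\kappa')}\right]^n,\qquad \nu=\left(\sqrt{GG'}-\sqrt{(G-1)(G'-1)}\right)^{-1}.$$ -/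

import Mathlib

open scoped InnerProductSpace Nat

noncomputable section

namespace Bosonic

/-! ### Hilbert spaces

`Fin M → ℕ` indexes the Fock (photon-number) basis of `M` bosonic modes.  The Hilbert space of
an idler system `H` together with `M` signal modes is `H ⊗ ℓ²(Fin M → ℕ)`, realised as the space
`ℓ²(Fin M → ℕ; H)` of square-summable `H`-valued families: `|χ⟩ ⊗ |𝐧⟩` is `lp.single 2 𝐧 χ`. -/

/-- The Hilbert space `H ⊗ ℓ²(X)`, as square-summable families `X → H`. -/
abbrev HilbertTensor (X : Type*) (H : Type*) [NormedAddCommGroup H] : Type _ :=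
  lp (fun _ : X => H) 2

/-- The Hilbert space of an idler `H` and `M` bosonic signal modes. -/
abbrev IdlerSignal (H : Type*) [NormedAddCommGroup H] (M : ℕ) : Type _ :=
  HilbertTensor (Fin M → ℕ) H

/-! ### Trace and fidelity -/

section Fidelity

variable {E : Type*} [NormedAddCommGroup E] [InnerProductSpace ℂ E] [CompleteSpace E]

/-- The trace `∑ᵢ ⟨eᵢ| T |eᵢ⟩` over a Hilbert basis.  For trace-class `T` the sum converges
absolutely and does not depend on the basis. -/
def trace (T : E →L[ℂ] E) : ℂ :=
  ∑' e : (exists_hilbertBasis ℂ E).choose, ⟪(e : E), T (e : E)⟫_ℂ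

/-- The fidelity `F(ρ, σ) = Tr √(√ρ σ √ρ)`. -/
def fidelity (ρ σ : E →L[ℂ] E) : ℝ :=
  (trace (CFC.sqrt (CFC.sqrt ρ * σ * CFC.sqrt ρ))).re

end Fidelity

/-! ### Two-mode dilations of the pure-loss channel and of the quantum-limited amplifier

A family `f : ℕ → ℕ → ℂ` is the table of Fock amplitudes `f j k = ⟨j, k | f⟩` of a vector of the
two-mode system formed by the signal mode (annihilation operator `a`) and the environment mode
(annihilation operator `e`). -/

/-- The creation operator `a†` of the signal mode. -/
def createS (f : ℕ → ℕ → ℂ) : ℕ → ℕ → ℂ := fun j k => (√(j : ℝ) : ℂ) * f (j - 1) k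

/-- The creation operator `e†` of the environment mode. -/
def createE (f : ℕ → ℕ → ℂ) : ℕ → ℕ → ℂ := fun j k => (√(k : ℝ) : ℂ) * f j (k - 1)

/-- The annihilation operator `e` of the environment mode. -/
def annihE (f : ℕ → ℕ → ℂ) : ℕ → ℕ → ℂ := fun j k => (√((k + 1 : ℕ) : ℝ) : ℂ) * f j (k + 1)

/-- The two-mode vacuum `|0, 0⟩`. -/
def vacuum : ℕ → ℕ → ℂ := fun j k => if j = 0 ∧ k = 0 then 1 else 0

/-- The two-mode squeezed vacuum `G^{-1/2} ∑ₖ ((G - 1)/G)^{k/2} |k, k⟩`, the image of the vacuum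
under the two-mode squeezing unitary of gain `G`. -/
def squeezedVacuum (G : ℝ) : ℕ → ℕ → ℂ :=
  fun j k => if j = k then (((√G)⁻¹ * √((G - 1) / G) ^ k : ℝ) : ℂ) else 0

/-- `U |n, 0⟩` for the beam-splitter unitary `U` of transmittance `κ`, for which
`U a† U† = √κ a† + √(1 - κ) e†` and `U |0, 0⟩ = |0, 0⟩`; so
`U |n, 0⟩ = (n!)^{-1/2} (√κ a† + √(1 - κ) e†)ⁿ |0, 0⟩`. -/
def lossDilation (κ : ℝ) (n : ℕ) : ℕ → ℕ → ℂ :=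
  ((√(n ! : ℝ))⁻¹ : ℂ) •
    (fun f => (√κ : ℂ) • createS f + (√(1 - κ) : ℂ) • createE f)^[n] vacuum

/-- `U |n, 0⟩` for the two-mode squeezing unitary `U` of gain `G`, for which
`U a† U† = √G a† - √(G - 1) e` (equivalently `U† a U = √G a + √(G - 1) e†`) and `U |0, 0⟩` is
the two-mode squeezed vacuum; so `U |n, 0⟩ = (n!)^{-1/2} (√G a† - √(G - 1) e)ⁿ U |0, 0⟩`. -/
def ampDilation (G : ℝ) (n : ℕ) : ℕ → ℕ → ℂ :=
  ((√(n ! : ℝ))⁻¹ : ℂ) •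
    (fun f => (√G : ℂ) • createS f - (√(G - 1) : ℂ) • annihE f)^[n] (squeezedVacuum G)

/-! ### Single-mode channels

A single-mode channel is given by a family of Kraus operators `K i`, each written in the Fock
basis: `K i m n = ⟨m| K i |n⟩`. -/

/-- The pure-loss channel `𝓛_κ`: the signal is mixed with a vacuum environment on a beam splitter
of transmittance `κ` and the environment is traced out, i.e. the Kraus operators are
`⟨l|_E U |0⟩_E`. -/
def lossKraus (κ : ℝ) : ℕ → ℕ → ℕ → ℂ := fun l m n => lossDilation κ n m l

/-- The quantum-limited amplifier `𝓐_G`: the signal undergoes two-mode squeezing of gain `G` with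
a vacuum environment and the environment is traced out. -/
def ampKraus (G : ℝ) : ℕ → ℕ → ℕ → ℂ := fun k m n => ampDilation G n m k

/-- The composition `𝓐 ∘ 𝓑` of two single-mode channels: its Kraus operators are the products
`A i * B j`. -/
def compKraus {ι ι' : Type*} (A : ι → ℕ → ℕ → ℂ) (B : ι' → ℕ → ℕ → ℂ) :
    ι × ι' → ℕ → ℕ → ℂ :=
  fun ij m n => ∑' r, A ij.1 m r * B ij.2 r n

/-- The `M`-fold tensor power of a single-mode channel: its Kraus operators are the tensor products
`K (i 1) ⊗ ⋯ ⊗ K (i M)`, written in the `M`-mode Fock basis. -/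
def tensorKraus {ι : Type*} (K : ι → ℕ → ℕ → ℂ) (M : ℕ) :
    (Fin M → ι) → (Fin M → ℕ) → (Fin M → ℕ) → ℂ :=
  fun i m n => ∏ s, K (i s) (m s) (n s)

/-! ### Action on operators of idler and signal -/

section Action

variable {X : Type*} [DecidableEq X]
variable (H : Type*) [NormedAddCommGroup H] [InnerProductSpace ℂ H]

/-- `T = id_H ⊗ A`, where `A` is the operator on `ℓ²(X)` with matrix `a`:
`T (|v⟩ ⊗ |n⟩) = ∑ₘ a m n |v⟩ ⊗ |m⟩`. -/
def IsIdTensor (a : X → X → ℂ) (T : HilbertTensor X H →L[ℂ] HilbertTensor X H) : Prop :=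
  ∀ (n : X) (v : H) (m : X), T (lp.single 2 n v) m = a m n • v

open Classical in
/-- The bounded operator `id_H ⊗ A`, where `A` is the operator on `ℓ²(X)` with matrix `a`; it is
unique (see `IsIdTensor.unique`), and for the Kraus operators used here it exists
(see `isIdTensor_cascade`).  The value is `0` if the matrix is not that of a bounded operator. -/
def idTensorOp (a : X → X → ℂ) : HilbertTensor X H →L[ℂ] HilbertTensor X H :=
  if h : ∃ T, IsIdTensor H a T then h.choose else 0

variable {H}

/-- The map `id_H ⊗ 𝓒`, `ρ ↦ ∑ᵢ (1 ⊗ Kᵢ) ρ (1 ⊗ Kᵢ)†`, where `𝓒` is the channel with Kraus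
operators `K i`.  For a density operator `ρ` and a trace-preserving `𝓒` the sum converges
absolutely in operator norm. -/
def applyChannel [CompleteSpace H] {ι : Type*} (K : ι → X → X → ℂ)
    (ρ : HilbertTensor X H →L[ℂ] HilbertTensor X H) :
    HilbertTensor X H →L[ℂ] HilbertTensor X H :=
  ∑' i, idTensorOp H (K i) ∘L ρ ∘L ContinuousLinearMap.adjoint (idTensorOp H (K i))

end Action

/-- The Kraus operators of the cascaded channel `(𝓐_G ∘ 𝓛_κ)^{⊗M}`. -/
def cascadeKraus (G κ : ℝ) (M : ℕ) :
    (Fin M → ℕ × ℕ) → (Fin M → ℕ) → (Fin M → ℕ) → ℂ :=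
  tensorKraus (compKraus (ampKraus G) (lossKraus κ)) M

/-! ### Well-definedness of the Kraus operators -/

section WellDefined

theorem IsIdTensor.unique {X : Type*} [DecidableEq X] {H : Type*} [NormedAddCommGroup H]
    [InnerProductSpace ℂ H] {a : X → X → ℂ} {S T : HilbertTensor X H →L[ℂ] HilbertTensor X H}
    (hS : IsIdTensor H a S) (hT : IsIdTensor H a T) : S = T := by
  ext1 f
  have h1 := (lp.hasSum_single (p := 2) (by simp) f).mapL S
  have h2 := (lp.hasSum_single (p := 2) (by simp) f).mapL T
  refine h1.unique (h2.congr_fun ?_)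
  intro n
  ext m
  rw [hS, hT]

theorem isIdTensor_idTensorOp {X : Type*} [DecidableEq X] {H : Type*} [NormedAddCommGroup H]
    [InnerProductSpace ℂ H] {a : X → X → ℂ} (h : ∃ T, IsIdTensor H a T) :
    IsIdTensor H a (idTensorOp H a) := by
  rw [idTensorOp, dif_pos h]
  exact h.choose_spec

/-- A matrix with entries of modulus at most one and at most one non-zero entry in each row and
column is that of a bounded operator. -/
theorem exists_isIdTensor {X : Type*} [DecidableEq X] (H : Type*) [NormedAddCommGroup H]
    [InnerProductSpace ℂ H] (a : X → X → ℂ) (hb : ∀ m n, ‖a m n‖ ≤ 1)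
    (hrow : ∀ m n n', a m n ≠ 0 → a m n' ≠ 0 → n = n')
    (hcol : ∀ m m' n, a m n ≠ 0 → a m' n ≠ 0 → m = m') :
    ∃ T, IsIdTensor H a T := by
  classical
  have hσ : ∀ m, ∃ s, ∀ n, n ≠ s → a m n = 0 := by
    intro m
    by_cases h : ∃ n, a m n ≠ 0
    · obtain ⟨s, hs⟩ := h
      exact ⟨s, fun n hn => by_contra fun h' => hn (hrow m n s h' hs)⟩
    · push Not at h
      exact ⟨m, fun n _ => h n⟩
  choose σ hσ using hσ
  have key : ∀ (f : HilbertTensor X H) (s : Finset X),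
      ∑ m ∈ s, ‖a m (σ m) • f (σ m)‖ ^ (2 : ENNReal).toReal ≤ ‖f‖ ^ (2 : ENNReal).toReal := by
    intro f s
    calc ∑ m ∈ s, ‖a m (σ m) • f (σ m)‖ ^ (2 : ENNReal).toReal
        = ∑ m ∈ s.filter (fun m => a m (σ m) ≠ 0),
            ‖a m (σ m) • f (σ m)‖ ^ (2 : ENNReal).toReal := by
          symm
          apply Finset.sum_filter_of_ne
          intro m _ h h0
          simp [h0] at h
      _ ≤ ∑ m ∈ s.filter (fun m => a m (σ m) ≠ 0), ‖f (σ m)‖ ^ (2 : ENNReal).toReal := by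
          apply Finset.sum_le_sum
          intro m _
          apply Real.rpow_le_rpow (norm_nonneg _) _ (by simp)
          rw [norm_smul]
          exact mul_le_of_le_one_left (norm_nonneg _) (hb _ _)
      _ = ∑ n ∈ (s.filter (fun m => a m (σ m) ≠ 0)).image σ,
            ‖f n‖ ^ (2 : ENNReal).toReal := by
          rw [Finset.sum_image]
          intro m hm m' hm' h
          simp only [Finset.coe_filter, Set.mem_ofPred_eq] at hm hm'
          exact hcol m m' (σ m) hm.2 (h ▸ hm'.2)
      _ ≤ _ := lp.sum_rpow_le_norm_rpow (by simp) f _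
  let L : HilbertTensor X H →ₗ[ℂ] HilbertTensor X H :=
    { toFun := fun f => ⟨fun m => a m (σ m) • f (σ m), memℓp_gen' (key f)⟩
      map_add' := by
        intro f g
        ext m
        exact smul_add _ _ _
      map_smul' := by
        intro c f
        ext m
        exact smul_comm _ _ _ }
  refine ⟨L.mkContinuous 1 fun f => ?_, fun n v m => ?_⟩
  · rw [one_mul]
    exact lp.norm_le_of_forall_sum_le (by simp) (norm_nonneg _) (key f)
  · change a m (σ m) • (lp.single 2 n v : HilbertTensor X H) (σ m) = _
    by_cases h : σ m = n
    · subst h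
      rw [lp.single_apply_self]
    · rw [lp.single_apply_ne _ _ _ h, hσ m n (Ne.symm h)]
      simp

theorem lossDilation_aux (x y : ℂ) (n m l : ℕ) :
    (fun f => x • createS f + y • createE f)^[n] vacuum m l =
      if m + l = n then (n ! : ℂ) * (((√(m ! : ℝ))⁻¹ * (√(l ! : ℝ))⁻¹ : ℝ) : ℂ) * x ^ m * y ^ l
      else 0 := by
  induction n generalizing m l with
  | zero =>
    rcases m with _ | m <;> rcases l with _ | l <;> simp [vacuum]
  | succ n ih =>
    have hs : ∀ k : ℕ, ((√((k : ℝ) + 1) : ℝ) : ℂ) * ((√((k : ℝ) + 1) : ℝ) : ℂ) = (k : ℂ) + 1 := by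
      intro k
      rw [← Complex.ofReal_mul, Real.mul_self_sqrt (by positivity)]
      simp
    have hn : ∀ k : ℕ, ((√((k : ℝ) + 1) : ℝ) : ℂ) ≠ 0 := by
      intro k
      exact_mod_cast (Real.sqrt_pos.2 (by positivity : (0 : ℝ) < (k : ℝ) + 1)).ne'
    have hf : ∀ k : ℕ, ((√(k ! : ℝ) : ℝ) : ℂ) ≠ 0 := by
      intro k
      exact_mod_cast (Real.sqrt_pos.2 (by positivity : (0 : ℝ) < (k ! : ℝ))).ne'
    rw [Function.iterate_succ_apply']
    simp only [Pi.add_apply, Pi.smul_apply, createS, createE, ih, smul_eq_mul]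
    rcases m with _ | m <;> rcases l with _ | l
    · simp
    · by_cases h : l = n
      · subst h
        have := hs l
        have := hn l
        have := hf l
        simp [Nat.factorial_succ, pow_succ]
        field_simp
        grind
      · simp [h]
    · by_cases h : m = n
      · subst h
        have := hs m
        have := hn m
        have := hf m
        simp [Nat.factorial_succ, pow_succ]
        field_simp
        grind
      · simp [h]
    · by_cases h : m + 1 + l = n
      · subst h
        have := hs l
        have := hn l
        have := hf l
        have := hs m
        have := hn m
        have := hf m
        have e1 : m + (l + 1) = m + 1 + l := by omega
        have e2 : m + 1 + (l + 1) = m + 1 + l + 1 := by omega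
        simp only [Nat.add_sub_cancel, e1, e2, if_true, Nat.factorial_succ]
        push_cast
        simp only [Real.sqrt_mul (by positivity : (0 : ℝ) ≤ (m : ℝ) + 1),
          Real.sqrt_mul (by positivity : (0 : ℝ) ≤ (l : ℝ) + 1), Complex.ofReal_mul, pow_succ]
        field_simp
        grind
      · have e1 : ¬ (m + (l + 1) = n) := by omega
        have e2 : ¬ (m + 1 + (l + 1) = n + 1) := by omega
        simp [h, e1, e2]

theorem sqrt_choose_eq (m l : ℕ) :
    √((m + l).choose l : ℝ) = √((m + l)! : ℝ) * (√(m ! : ℝ))⁻¹ * (√(l ! : ℝ))⁻¹ := by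
  have h : (((m + l).choose l : ℕ) : ℝ) = (m + l)! * (m ! : ℝ)⁻¹ * (l ! : ℝ)⁻¹ := by
    have := Nat.add_choose_mul_factorial_mul_factorial m l
    have h2 : ((m + l).choose l : ℝ) * m ! * l ! = (m + l)! := by exact_mod_cast this
    rw [← h2]
    field_simp
  rw [h, Real.sqrt_mul (by positivity), Real.sqrt_mul (by positivity), Real.sqrt_inv,
    Real.sqrt_inv]

/-- The beam-splitter amplitudes
`U |n, 0⟩ = ∑_{m + l = n} √(n choose l) κ^{m/2} (1 - κ)^{l/2} |m, l⟩`. -/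
theorem lossKraus_eq (κ : ℝ) (l m n : ℕ) :
    lossKraus κ l m n =
      if n = m + l then ((√((m + l).choose l : ℝ) * √κ ^ m * √(1 - κ) ^ l : ℝ) : ℂ) else 0 := by
  simp only [lossKraus, lossDilation, Pi.smul_apply, lossDilation_aux, smul_eq_mul]
  by_cases h : n = m + l
  · subst h
    have hf : ((√((m + l)! : ℝ) : ℝ) : ℂ) ≠ 0 := by
      exact_mod_cast (Real.sqrt_pos.2 (by positivity : (0 : ℝ) < ((m + l)! : ℝ))).ne'
    have hs : (((m + l)! : ℕ) : ℂ) = ((√((m + l)! : ℝ) : ℝ) : ℂ) * ((√((m + l)! : ℝ) : ℝ) : ℂ) := by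
      rw [← Complex.ofReal_mul, Real.mul_self_sqrt (by positivity)]
      simp
    simp only [if_true, sqrt_choose_eq]
    rw [hs]
    push_cast
    field_simp
  · simp [h, Ne.symm h]

theorem ampDilation_aux {G : ℝ} (hG : 1 ≤ G) (n m k : ℕ) :
    (fun f => (√G : ℂ) • createS f - (√(G - 1) : ℂ) • annihE f)^[n] (squeezedVacuum G) m k =
      if m = n + k then
        ((√((n + k)! : ℝ) * (√(k ! : ℝ))⁻¹ * (√G)⁻¹ ^ (n + 1) * √((G - 1) / G) ^ k : ℝ) : ℂ)
      else 0 := by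
  induction n generalizing m k with
  | zero =>
    have hf : √(k ! : ℝ) ≠ 0 := (Real.sqrt_pos.2 (by positivity)).ne'
    by_cases h : m = k
    · simp [squeezedVacuum, h, hf]
    · simp [squeezedVacuum, h]
  | succ n ih =>
    rw [Function.iterate_succ_apply']
    simp only [Pi.sub_apply, Pi.smul_apply, createS, annihE, ih, smul_eq_mul]
    by_cases h : m = n + 1 + k
    · subst h
      have e1 : n + 1 + k - 1 = n + k := by omega
      have e2 : n + 1 + k = n + (k + 1) := by omega
      have e3 : (n + 1 + k)! = (n + 1 + k) * (n + k)! := by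
        rw [show n + 1 + k = (n + k) + 1 by omega, Nat.factorial_succ]
      simp only [e1, if_true, ← e2]
      rw [← Complex.ofReal_mul, ← Complex.ofReal_mul, ← Complex.ofReal_mul, ← Complex.ofReal_mul,
        ← Complex.ofReal_sub, Complex.ofReal_inj, e3, Nat.factorial_succ]
      push_cast
      have hG0 : 0 < G := by linarith
      have hg : 0 < √G := Real.sqrt_pos.2 hG0
      have hgg : √G * √G = G := Real.mul_self_sqrt hG0.le
      have hh : √(G - 1) * √(G - 1) = G - 1 := Real.mul_self_sqrt (by linarith)
      have hk : 0 < √((k : ℝ) + 1) := Real.sqrt_pos.2 (by positivity)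
      have hf : 0 < √(k ! : ℝ) := Real.sqrt_pos.2 (by positivity)
      rw [Real.sqrt_mul (by positivity), Real.sqrt_mul (by positivity : (0 : ℝ) ≤ (k : ℝ) + 1),
        pow_succ √((G - 1) / G), Real.sqrt_div (by linarith), pow_succ (√G)⁻¹ (n + 1)]
      generalize (√(G - 1) / √G) ^ k = t
      generalize (√G)⁻¹ ^ (n + 1) = u
      field_simp
      grind
    · have e1 : ¬ (m = n + (k + 1)) := by omega
      rcases m with _ | m
      · simp [h]
      · have e2 : ¬ (m = n + k) := by omega
        simp only [Nat.add_sub_cancel, e1, e2, h, if_false]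
        simp

/-- The two-mode-squeezing amplitudes
`U |n, 0⟩ = G^{-(n+1)/2} ∑ₖ √(n+k choose k) ((G - 1)/G)^{k/2} |n + k, k⟩`. -/
theorem ampKraus_eq {G : ℝ} (hG : 1 ≤ G) (k m n : ℕ) :
    ampKraus G k m n =
      if m = n + k then
        ((√((n + k).choose k : ℝ) * (√G)⁻¹ ^ (n + 1) * √((G - 1) / G) ^ k : ℝ) : ℂ)
      else 0 := by
  simp only [ampKraus, ampDilation, Pi.smul_apply, ampDilation_aux hG, smul_eq_mul]
  by_cases h : m = n + k
  · simp only [h, if_true, sqrt_choose_eq]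
    push_cast
    ring
  · simp [h]

theorem sqrt_choose_mul_pow_le {u v : ℝ} (hu : 0 ≤ u) (hv : 0 ≤ v) (huv : u + v = 1) (m l : ℕ) :
    √((m + l).choose l : ℝ) * √u ^ m * √v ^ l ≤ 1 := by
  have h1 : ((m + l).choose l : ℝ) * u ^ m * v ^ l ≤ 1 := by
    have h := add_pow u v (m + l)
    rw [huv, one_pow] at h
    rw [h]
    have := Finset.single_le_sum (f := fun i => u ^ i * v ^ (m + l - i) * ((m + l).choose i : ℝ))
      (s := Finset.range (m + l + 1)) (fun i _ => by positivity)
      (Finset.mem_range.2 (by omega : m < m + l + 1))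
    refine le_trans (le_of_eq ?_) this
    simp only [Nat.add_sub_cancel_left]
    rw [Nat.choose_symm_add]
    ring
  refine (sq_le_one_iff₀ (by positivity)).1 (le_trans (le_of_eq ?_) h1)
  rw [mul_pow, mul_pow, ← pow_mul, ← pow_mul, mul_comm m, mul_comm l 2, pow_mul, pow_mul,
    Real.sq_sqrt hu, Real.sq_sqrt hv, Real.sq_sqrt (by positivity)]

theorem norm_lossKraus_le {κ : ℝ} (hκ : κ ∈ Set.Icc (0 : ℝ) 1) (l m n : ℕ) :
    ‖lossKraus κ l m n‖ ≤ 1 := by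
  rw [lossKraus_eq]
  split_ifs
  · rw [Complex.norm_real, Real.norm_of_nonneg (by positivity)]
    exact sqrt_choose_mul_pow_le hκ.1 (by linarith [hκ.2]) (by ring) m l
  · simp

theorem norm_ampKraus_le {G : ℝ} (hG : 1 ≤ G) (k m n : ℕ) : ‖ampKraus G k m n‖ ≤ 1 := by
  have hG0 : 0 < G := by linarith
  rw [ampKraus_eq hG]
  split_ifs
  · rw [Complex.norm_real, Real.norm_of_nonneg (by positivity)]
    have h := sqrt_choose_mul_pow_le (inv_nonneg.2 hG0.le)
      (div_nonneg (by linarith) hG0.le : 0 ≤ (G - 1) / G) (by field_simp; ring) n k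
    rw [Real.sqrt_inv] at h
    have h1 : (√G)⁻¹ ≤ 1 := inv_le_one_of_one_le₀ (Real.one_le_sqrt.2 hG)
    calc _ = (√((n + k).choose k : ℝ) * (√G)⁻¹ ^ n * √((G - 1) / G) ^ k) * (√G)⁻¹ := by
          rw [pow_succ]
          ring
      _ ≤ 1 := mul_le_one₀ h (by positivity) h1
  · simp

/-- Matrix elements of the single-mode Kraus operators of `𝓐_G ∘ 𝓛_κ`. -/
theorem compKraus_eq (G κ : ℝ) (i : ℕ × ℕ) (m n : ℕ) :
    compKraus (ampKraus G) (lossKraus κ) i m n =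
      ampKraus G i.1 m (n - i.2) * lossKraus κ i.2 (n - i.2) n := by
  refine tsum_eq_single (n - i.2) fun r hr => ?_
  rw [lossKraus_eq, if_neg (by omega), mul_zero]

theorem compKraus_ne_zero {G : ℝ} (hG : 1 ≤ G) {κ : ℝ} {i : ℕ × ℕ} {m n : ℕ}
    (h : compKraus (ampKraus G) (lossKraus κ) i m n ≠ 0) : m + i.2 = n + i.1 := by
  rw [compKraus_eq, lossKraus_eq, ampKraus_eq hG] at h
  by_contra hne
  apply h
  split_ifs <;> first | omega | simp

/-- The Kraus operators of `id ⊗ (𝓐_G ∘ 𝓛_κ)^{⊗M}` are bounded operators. -/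
theorem isIdTensor_cascade (H : Type*) [NormedAddCommGroup H] [InnerProductSpace ℂ H]
    {G κ : ℝ} (hG : 1 ≤ G) (hκ : κ ∈ Set.Icc (0 : ℝ) 1) (M : ℕ) (i : Fin M → ℕ × ℕ) :
    IsIdTensor H (cascadeKraus G κ M i) (idTensorOp H (cascadeKraus G κ M i)) := by
  apply isIdTensor_idTensorOp
  have hne : ∀ m n : Fin M → ℕ, cascadeKraus G κ M i m n ≠ 0 →
      ∀ s, m s + (i s).2 = n s + (i s).1 := by
    intro m n h s
    rw [cascadeKraus, tensorKraus] at h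
    exact compKraus_ne_zero hG (Finset.prod_ne_zero_iff.1 h s (Finset.mem_univ s))
  apply exists_isIdTensor
  · intro m n
    rw [cascadeKraus, tensorKraus, norm_prod]
    refine Finset.prod_le_one (fun _ _ => norm_nonneg _) fun s _ => ?_
    rw [compKraus_eq, norm_mul]
    exact mul_le_one₀ (norm_ampKraus_le hG _ _ _) (norm_nonneg _) (norm_lossKraus_le hκ _ _ _)
  · intro m n n' h h'
    funext s
    have := hne _ _ h s
    have := hne _ _ h' s
    omega
  · intro m m' n h h'
    funext s
    have := hne _ _ h s
    have := hne _ _ h' s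
    omega

end WellDefined

/-! ### Number-diagonal signal (NDS) probes -/

/-- The data of an NDS probe: a probability distribution `p` of the `M`-mode photon numbers and an
orthonormal family `χ` of idler states. -/
structure NDSProbe (H : Type*) [NormedAddCommGroup H] [InnerProductSpace ℂ H] (M : ℕ) where
  p : (Fin M → ℕ) → ℝ
  χ : (Fin M → ℕ) → H
  p_nonneg : ∀ n, 0 ≤ p n
  p_hasSum : HasSum p 1
  orthonormal : Orthonormal ℂ χ

namespace NDSProbe

variable {H : Type*} [NormedAddCommGroup H] [InnerProductSpace ℂ H] {M : ℕ}

theorem memℓp_ket (P : NDSProbe H M) :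
    Memℓp (fun n : Fin M → ℕ => ((√(P.p n) : ℝ) : ℂ) • P.χ n) 2 := by
  apply memℓp_gen
  refine P.p_hasSum.summable.congr fun n => ?_
  simp [norm_smul, P.orthonormal.1 n, abs_of_nonneg, Real.sq_sqrt (P.p_nonneg n)]

/-- The state vector `|ψ⟩ = ∑_𝐧 √(p_𝐧) |χ_𝐧⟩ |𝐧⟩`. -/
def ket (P : NDSProbe H M) : IdlerSignal H M :=
  ⟨fun n => ((√(P.p n) : ℝ) : ℂ) • P.χ n, P.memℓp_ket⟩

theorem hasSum_ket (P : NDSProbe H M) :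
    HasSum (fun n => ((√(P.p n) : ℝ) : ℂ) •
      (lp.single 2 n (P.χ n) : IdlerSignal H M)) P.ket := by
  have h := lp.hasSum_single (p := 2) (by simp) P.ket
  simpa only [ket, lp.single_smul] using h

/-- The density operator `Ψ = |ψ⟩⟨ψ|`. -/
def state (P : NDSProbe H M) : IdlerSignal H M →L[ℂ] IdlerSignal H M :=
  InnerProductSpace.rankOne ℂ P.ket P.ket

/-- The probability `p_n = ∑_{𝐧 : n₁ + ⋯ + n_M = n} p_𝐧` of `n` photons in total. -/
def totalPMF (P : NDSProbe H M) (n : ℕ) : ℝ :=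
  ∑ k ∈ Finset.piAntidiag Finset.univ n, P.p k

end NDSProbe

/-- `ν = (√(G G') - √((G - 1)(G' - 1)))⁻¹`. -/
def nu (G G' : ℝ) : ℝ := (√(G * G') - √((G - 1) * (G' - 1)))⁻¹

end Bosonic

end

/-!
The states `∑ᵢ |vᵢ⟩⟨vᵢ|` and `∑ᵢ |wᵢ⟩⟨wᵢ|` are the marginals of the vectors `∑ᵢ vᵢ ⊗ |i⟩` and
`∑ᵢ wᵢ ⊗ |i⟩`, so their fidelity is at least `Re ∑ᵢ ⟨vᵢ, wᵢ⟩` by the easy half of Uhlmann's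
theorem: polar decomposition turns this overlap into a trace of the form `Tr (D† |T| C)` with
contractions `C` and `D`, which is at most `Tr |T|`.

Take for `vᵢ` and `wᵢ` the images of the probe under the Kraus operators of the two channels.
The vectors `|χ_𝐧⟩` are orthonormal, so no cross terms between different `𝐧` survive, and the
overlap is `∑_𝐧 p_𝐧 ⟨V 𝐧, V' 𝐧⟩` with `V`, `V'` the Stinespring isometries of the channels. These
inner products factor over the modes. On one mode holding `n` photons, losing `l` of them
contributes the term `C(n, l) √((1-κ)(1-κ'))ˡ √(κκ')ⁿ⁻ˡ`, and amplifying the remaining `r = n - l`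
contributes a negative binomial series with sum `νʳ⁺¹`; the sum over `l` is then evaluated by the
binomial theorem.
-/

noncomputable section

namespace Bosonic

open ContinuousLinearMap
open scoped ENNReal ComplexOrder

/-! ### Hilbert–Schmidt operators and fidelity -/

section HilbertSchmidt

variable {ι κ E F K : Type*}
  [NormedAddCommGroup E] [InnerProductSpace ℂ E]
  [NormedAddCommGroup F] [InnerProductSpace ℂ F]
  [NormedAddCommGroup K] [InnerProductSpace ℂ K]

theorem tsum_enorm_inner_sq (b : HilbertBasis ι ℂ E) (x : E) :
    ∑' i, ‖⟪b i, x⟫_ℂ‖ₑ ^ 2 = ‖x‖ₑ ^ 2 := by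
  have parseval : HasSum (fun i => ‖⟪b i, x⟫_ℂ‖ ^ 2) (‖x‖ ^ 2) := by
    simpa [b.repr_apply_apply] using lp.hasSum_norm (p := 2) (by simp) (b.repr x)
  have h := ENNReal.ofReal_tsum_of_nonneg (fun _ => sq_nonneg _) parseval.summable
  simpa only [parseval.tsum_eq, ENNReal.ofReal_pow (norm_nonneg _), ofReal_norm] using h.symm

theorem enorm_inner_le_sq_add_sq (x y : E) : ‖⟪x, y⟫_ℂ‖ₑ ≤ ‖x‖ₑ ^ 2 + ‖y‖ₑ ^ 2 := by
  simp only [← ofReal_norm, ← ENNReal.ofReal_pow (norm_nonneg _)]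
  rw [← ENNReal.ofReal_add (by positivity) (by positivity)]
  gcongr
  nlinarith [norm_inner_le_norm (𝕜 := ℂ) x y, sq_nonneg (‖x‖ - ‖y‖), sq_nonneg ‖x‖,
    sq_nonneg ‖y‖]

theorem exists_norm_le_one_comp_eq [CompleteSpace F] [CompleteSpace K] (S : E →L[ℂ] K)
    (T : E →L[ℂ] F) (h : ∀ x, ‖S x‖ ≤ ‖T x‖) : ∃ C : F →L[ℂ] K, ‖C‖ ≤ 1 ∧ C ∘L T = S := by
  set W : Submodule ℂ F := (LinearMap.range T.toLinearMap).topologicalClosure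
  let T' : E →ₗ[ℂ] W := T.toLinearMap.codRestrict W fun x =>
    Submodule.le_topologicalClosure _ (LinearMap.mem_range_self T.toLinearMap x)
  have : CompleteSpace W := (Submodule.isClosed_topologicalClosure _).completeSpace_coe
  have dense_range : DenseRange T' := Subtype.dense_iff.2 fun y hy => by
    rw [← Set.range_comp]
    exact hy
  have bound : ∀ x, ‖S.toLinearMap x‖ ≤ 1 * ‖T' x‖ := fun x => by
    rw [one_mul]
    exact h x
  refine ⟨S.toLinearMap.extendOfNorm T' ∘L W.orthogonalProjectionOnto, ?_, ?_⟩
  · exact (opNorm_comp_le _ _).trans (mul_le_one₀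
      (LinearMap.opNorm_extendOfNorm_le dense_range zero_le_one bound) (norm_nonneg _)
      W.orthogonalProjectionOnto_norm_le)
  · ext x
    have projection_apply : W.orthogonalProjectionOnto (T x) = T' x :=
      Submodule.orthogonalProjectionOnto_mem_subspace_eq_self (T' x)
    rw [comp_apply, comp_apply, projection_apply,
      LinearMap.extendOfNorm_eq dense_range ⟨1, bound⟩, coe_coe]

variable [CompleteSpace E]

/-- The squared Hilbert–Schmidt norm `∑ᵢ ‖T eᵢ‖²` of `T`, which is `∞` unless `T` is a
Hilbert–Schmidt operator. The basis is the one chosen in `trace`; by `hsNormSq_eq_tsum` every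
Hilbert basis gives the same value. -/
def hsNormSq (T : E →L[ℂ] K) : ℝ≥0∞ :=
  ∑' e : (exists_hilbertBasis ℂ E).choose, ‖T (e : E)‖ₑ ^ 2

theorem hsNormSq_comp_le_left (S : F →L[ℂ] K) (T : E →L[ℂ] F) :
    hsNormSq (S ∘L T) ≤ ‖S‖ₑ ^ 2 * hsNormSq T := by
  rw [hsNormSq, hsNormSq, ← ENNReal.tsum_mul_left]
  refine ENNReal.tsum_le_tsum fun e => ?_
  rw [← mul_pow]
  gcongr
  exact S.le_opENorm (T e)

variable [CompleteSpace F]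

theorem tsum_enorm_apply_sq_eq_tsum_adjoint (b : HilbertBasis ι ℂ E) (c : HilbertBasis κ ℂ F)
    (T : E →L[ℂ] F) : ∑' i, ‖T (b i)‖ₑ ^ 2 = ∑' j, ‖adjoint T (c j)‖ₑ ^ 2 := by
  simp_rw [← tsum_enorm_inner_sq c, ← tsum_enorm_inner_sq b]
  rw [ENNReal.tsum_comm]
  refine tsum_congr fun j => tsum_congr fun i => ?_
  rw [adjoint_inner_right, ← inner_conj_symm, RCLike.enorm_conj]

theorem hsNormSq_eq_tsum (b : HilbertBasis ι ℂ E) (T : E →L[ℂ] F) :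
    hsNormSq T = ∑' i, ‖T (b i)‖ₑ ^ 2 := by
  obtain ⟨g, hg⟩ := (exists_hilbertBasis ℂ E).choose_spec
  obtain ⟨_, c, -⟩ := exists_hilbertBasis ℂ F
  rw [tsum_enorm_apply_sq_eq_tsum_adjoint b c, ← tsum_enorm_apply_sq_eq_tsum_adjoint g c, hg,
    hsNormSq]

theorem hsNormSq_adjoint (T : E →L[ℂ] F) : hsNormSq (adjoint T) = hsNormSq T := by
  obtain ⟨_, b, -⟩ := exists_hilbertBasis ℂ E
  obtain ⟨_, c, -⟩ := exists_hilbertBasis ℂ F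
  rw [hsNormSq_eq_tsum b, hsNormSq_eq_tsum c, tsum_enorm_apply_sq_eq_tsum_adjoint b c]

theorem hsNormSq_comp_le_of_norm_le_one [CompleteSpace K] (S : F →L[ℂ] K) {C : E →L[ℂ] F}
    (hC : ‖C‖ ≤ 1) : hsNormSq (S ∘L C) ≤ hsNormSq S := by
  have enorm_le : ‖adjoint C‖ₑ ≤ 1 := by
    rwa [← ofReal_norm, LinearIsometryEquiv.norm_map, ENNReal.ofReal_le_one]
  calc hsNormSq (S ∘L C) = hsNormSq (adjoint C ∘L adjoint S) := by
        rw [← adjoint_comp, hsNormSq_adjoint]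
    _ ≤ ‖adjoint C‖ₑ ^ 2 * hsNormSq (adjoint S) := hsNormSq_comp_le_left _ _
    _ ≤ hsNormSq S := by
        rw [hsNormSq_adjoint]
        exact mul_le_of_le_one_left' (pow_le_one' enorm_le 2)

theorem adjoint_eq_self_of_nonneg {T : E →L[ℂ] E} (hT : 0 ≤ T) : adjoint T = T :=
  ((nonneg_iff_isPositive T).1 hT).isSelfAdjoint.adjoint_eq

theorem inner_apply_eq_inner_sqrt {T : E →L[ℂ] E} (hT : 0 ≤ T) (x y : E) :
    ⟪T x, y⟫_ℂ = ⟪CFC.sqrt T x, CFC.sqrt T y⟫_ℂ := by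
  rw [← adjoint_inner_left, adjoint_eq_self_of_nonneg (CFC.sqrt_nonneg T), ← mul_apply_eq_comp,
    CFC.sqrt_mul_sqrt_self T hT]

theorem re_trace_of_nonneg {T : E →L[ℂ] E} (hT : 0 ≤ T) :
    (trace T).re = (hsNormSq (CFC.sqrt T)).toReal := by
  have inner_eq (x : E) : ⟪x, T x⟫_ℂ = ((‖CFC.sqrt T x‖ₑ ^ 2).toReal : ℂ) := by
    rw [← inner_conj_symm, inner_apply_eq_inner_sqrt hT, inner_self_eq_norm_sq_to_K]
    simp
  rw [trace, hsNormSq, ENNReal.tsum_toReal_eq fun _ => by finiteness]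
  simp_rw [inner_eq]
  rw [← Complex.ofReal_tsum, Complex.ofReal_re]

theorem hsNormSq_sqrt_adjoint_comp_le {X Y : E →L[ℂ] F} (h : 0 ≤ adjoint X ∘L Y) :
    hsNormSq (CFC.sqrt (adjoint X ∘L Y)) ≤ hsNormSq X + hsNormSq Y := by
  rw [hsNormSq, hsNormSq, hsNormSq, ← ENNReal.tsum_add]
  refine ENNReal.tsum_le_tsum fun e => ?_
  have norm_sq_eq : ‖CFC.sqrt (adjoint X ∘L Y) e‖ ^ 2 = ‖⟪Y (e : E), X (e : E)⟫_ℂ‖ := by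
    rw [← adjoint_inner_left, ← comp_apply, inner_apply_eq_inner_sqrt h, inner_self_eq_norm_sq_to_K]
    simp
  calc ‖CFC.sqrt (adjoint X ∘L Y) e‖ₑ ^ 2 = ‖⟪Y (e : E), X (e : E)⟫_ℂ‖ₑ := by
        rw [← ofReal_norm, ← ENNReal.ofReal_pow (norm_nonneg _), norm_sq_eq, ofReal_norm]
    _ ≤ ‖X (e : E)‖ₑ ^ 2 + ‖Y (e : E)‖ₑ ^ 2 :=
        (enorm_inner_le_sq_add_sq _ _).trans_eq (add_comm _ _)

/-- The absolute value `|T| = √(T† T)` of an operator between Hilbert spaces. -/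
def modulus (T : E →L[ℂ] F) : E →L[ℂ] E :=
  CFC.sqrt (adjoint T ∘L T)

theorem adjoint_comp_self_nonneg (T : E →L[ℂ] F) : 0 ≤ adjoint T ∘L T :=
  (nonneg_iff_isPositive _).2 (isPositive_adjoint_comp_self T)

theorem modulus_nonneg (T : E →L[ℂ] F) : 0 ≤ modulus T :=
  CFC.sqrt_nonneg _

theorem norm_modulus_apply (T : E →L[ℂ] F) (x : E) : ‖modulus T x‖ = ‖T x‖ := by
  have inner_eq : ⟪modulus T x, modulus T x⟫_ℂ = ⟪T x, T x⟫_ℂ := by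
    rw [modulus, ← inner_apply_eq_inner_sqrt (adjoint_comp_self_nonneg T), comp_apply,
      adjoint_inner_left]
  rw [norm_eq_sqrt_re_inner (𝕜 := ℂ), inner_eq, ← norm_eq_sqrt_re_inner]

theorem exists_norm_le_one_comp_modulus_eq (T : E →L[ℂ] F) :
    ∃ U : E →L[ℂ] F, ‖U‖ ≤ 1 ∧ U ∘L modulus T = T :=
  exists_norm_le_one_comp_eq T (modulus T) fun x => (norm_modulus_apply T x).ge

theorem exists_norm_le_one_comp_eq_modulus (T : E →L[ℂ] F) :
    ∃ U : F →L[ℂ] E, ‖U‖ ≤ 1 ∧ U ∘L T = modulus T :=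
  exists_norm_le_one_comp_eq (modulus T) T fun x => (norm_modulus_apply T x).le

theorem hsNormSq_modulus (T : E →L[ℂ] F) : hsNormSq (modulus T) = hsNormSq T := by
  simp only [hsNormSq, ← ofReal_norm, norm_modulus_apply]

/-- Since `|X† Y| = (X U†)† Y` for a contraction `U`, this makes `|X† Y|` a trace-class operator
whenever `X` and `Y` are Hilbert–Schmidt operators. -/
theorem hsNormSq_sqrt_modulus_adjoint_comp_le [CompleteSpace K] (X : E →L[ℂ] K) (Y : F →L[ℂ] K) :
    hsNormSq (CFC.sqrt (modulus (adjoint X ∘L Y))) ≤ hsNormSq X + hsNormSq Y := by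
  obtain ⟨U, hU, modulus_eq⟩ := exists_norm_le_one_comp_eq_modulus (adjoint X ∘L Y)
  have factor : modulus (adjoint X ∘L Y) = adjoint (X ∘L adjoint U) ∘L Y := by
    rw [adjoint_comp, adjoint_adjoint, ← modulus_eq, comp_assoc]
  have h := modulus_nonneg (adjoint X ∘L Y)
  rw [factor] at h ⊢
  refine (hsNormSq_sqrt_adjoint_comp_le h).trans (add_le_add_left ?_ _)
  exact hsNormSq_comp_le_of_norm_le_one X (by rwa [LinearIsometryEquiv.norm_map])

theorem sum_norm_sq_le_toReal_hsNormSq (b : HilbertBasis ι ℂ E) {T : E →L[ℂ] F}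
    (hT : hsNormSq T ≠ ⊤) (s : Finset ι) : ∑ i ∈ s, ‖T (b i)‖ ^ 2 ≤ (hsNormSq T).toReal := by
  rw [← ENNReal.ofReal_le_iff_le_toReal hT, ENNReal.ofReal_sum_of_nonneg fun _ _ => sq_nonneg _,
    hsNormSq_eq_tsum b]
  simp only [ENNReal.ofReal_pow (norm_nonneg _), ofReal_norm]
  exact ENNReal.sum_le_tsum s

/-- The duality between trace norm and operator norm, for a positive trace-class operator. -/
theorem tsum_re_inner_le_re_trace {B : E →L[ℂ] E} (hB : 0 ≤ B)
    (hB_trace : hsNormSq (CFC.sqrt B) ≠ ⊤) (b : HilbertBasis ι ℂ F) {C D : F →L[ℂ] E}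
    (hC : ‖C‖ ≤ 1) (hD : ‖D‖ ≤ 1) :
    ∑' i, (⟪B (C (b i)), D (b i)⟫_ℂ).re ≤ (trace B).re := by
  set R := CFC.sqrt B
  have sum_le {Z : F →L[ℂ] E} (hZ : ‖Z‖ ≤ 1) (s : Finset ι) :
      ∑ i ∈ s, ‖R (Z (b i))‖ ^ 2 ≤ (hsNormSq R).toReal := by
    have hRZ := hsNormSq_comp_le_of_norm_le_one R hZ
    exact (sum_norm_sq_le_toReal_hsNormSq b (ne_top_of_le_ne_top hB_trace hRZ) s).trans
      (ENNReal.toReal_mono hB_trace hRZ)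
  have term_le (i : ι) : (⟪B (C (b i)), D (b i)⟫_ℂ).re ≤
      (‖R (C (b i))‖ ^ 2 + ‖R (D (b i))‖ ^ 2) / 2 := by
    rw [inner_apply_eq_inner_sqrt hB]
    have := re_inner_le_norm (𝕜 := ℂ) (R (C (b i))) (R (D (b i)))
    rw [RCLike.re_eq_complex_re] at this
    nlinarith [sq_nonneg (‖R (C (b i))‖ - ‖R (D (b i))‖)]
  rw [re_trace_of_nonneg hB]
  refine tsum_le_of_sum_le' ENNReal.toReal_nonneg fun s => ?_
  calc ∑ i ∈ s, (⟪B (C (b i)), D (b i)⟫_ℂ).re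
      ≤ ∑ i ∈ s, (‖R (C (b i))‖ ^ 2 + ‖R (D (b i))‖ ^ 2) / 2 :=
        Finset.sum_le_sum fun i _ => term_le i
    _ = (∑ i ∈ s, ‖R (C (b i))‖ ^ 2 + ∑ i ∈ s, ‖R (D (b i))‖ ^ 2) / 2 := by
        rw [← Finset.sum_add_distrib, Finset.sum_div]
    _ ≤ (hsNormSq R).toReal := by linarith [sum_le hC s, sum_le hD s]

theorem fidelity_comp_adjoint (V W : F →L[ℂ] E) :
    fidelity (V ∘L adjoint V) (W ∘L adjoint W) =
      (trace (modulus (adjoint W ∘L modulus (adjoint V)))).re := by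
  have sqrt_eq : CFC.sqrt (V ∘L adjoint V) = modulus (adjoint V) := by
    rw [modulus, adjoint_adjoint]
  rw [fidelity, sqrt_eq, modulus.eq_def (adjoint W ∘L _), adjoint_comp, adjoint_adjoint,
    adjoint_eq_self_of_nonneg (modulus_nonneg _)]
  rfl

/-- One half of Uhlmann's theorem. -/
theorem tsum_re_inner_le_fidelity (b : HilbertBasis ι ℂ F) (V W : F →L[ℂ] E)
    (hV : hsNormSq V ≠ ⊤) (hW : hsNormSq W ≠ ⊤) :
    ∑' i, (⟪V (b i), W (b i)⟫_ℂ).re ≤ fidelity (V ∘L adjoint V) (W ∘L adjoint W) := by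
  obtain ⟨C, hC, V_polar⟩ := exists_norm_le_one_comp_modulus_eq (adjoint V)
  obtain ⟨U, hU, T_polar⟩ := exists_norm_le_one_comp_modulus_eq (adjoint W ∘L modulus (adjoint V))
  have V_eq : V = modulus (adjoint V) ∘L adjoint C := by
    rw [← adjoint_eq_self_of_nonneg (modulus_nonneg (adjoint V)), ← adjoint_comp, V_polar,
      adjoint_adjoint]
  set B := modulus (adjoint W ∘L modulus (adjoint V))
  have inner_eq (i : ι) :
      ⟪V (b i), W (b i)⟫_ℂ = ⟪B (adjoint C (b i)), adjoint U (b i)⟫_ℂ := by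
    rw [adjoint_inner_right, ← comp_apply U B, T_polar, comp_apply, adjoint_inner_left,
      ← comp_apply, ← V_eq]
  have trace_class : hsNormSq (CFC.sqrt B) ≠ ⊤ := by
    refine ne_top_of_le_ne_top ?_ (hsNormSq_sqrt_modulus_adjoint_comp_le W (modulus (adjoint V)))
    rw [hsNormSq_modulus, hsNormSq_adjoint]
    exact ENNReal.add_ne_top.2 ⟨hW, hV⟩
  simp_rw [inner_eq]
  rw [fidelity_comp_adjoint]
  exact tsum_re_inner_le_re_trace (modulus_nonneg _) trace_class b
    (by rwa [LinearIsometryEquiv.norm_map]) (by rwa [LinearIsometryEquiv.norm_map])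

end HilbertSchmidt

section Ensembles

variable {ι E : Type*} [NormedAddCommGroup E] [InnerProductSpace ℂ E] {v w : ι → E}

theorem sum_norm_inner_rpow_le (hv : Summable fun i => ‖v i‖ ^ 2) (x : E) (s : Finset ι) :
    ∑ i ∈ s, ‖⟪v i, x⟫_ℂ‖ ^ (2 : ℝ≥0∞).toReal ≤
      (√(∑' i, ‖v i‖ ^ 2) * ‖x‖) ^ (2 : ℝ≥0∞).toReal := by
  simp only [ENNReal.toReal_ofNat, Real.rpow_ofNat]
  calc ∑ i ∈ s, ‖⟪v i, x⟫_ℂ‖ ^ 2 ≤ ∑ i ∈ s, ‖v i‖ ^ 2 * ‖x‖ ^ 2 := by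
        gcongr with i
        rw [← mul_pow]
        gcongr
        exact norm_inner_le_norm _ _
    _ ≤ (∑' i, ‖v i‖ ^ 2) * ‖x‖ ^ 2 := by
        rw [← Finset.sum_mul]
        gcongr
        exact hv.sum_le_tsum _ fun _ _ => sq_nonneg _
    _ = (√(∑' i, ‖v i‖ ^ 2) * ‖x‖) ^ 2 := by
        rw [mul_pow, Real.sq_sqrt (tsum_nonneg fun _ => sq_nonneg _)]

/-- The analysis operator `x ↦ (⟨vᵢ, x⟩)ᵢ` of a square-summable family `v`. Its adjoint maps the
`i`-th standard basis vector to `v i`, so that `L† L = ∑ᵢ |vᵢ⟩⟨vᵢ|`. -/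
def analysis (v : ι → E) (hv : Summable fun i => ‖v i‖ ^ 2) : E →L[ℂ] lp (fun _ : ι => ℂ) 2 :=
  LinearMap.mkContinuous
    { toFun x := ⟨fun i => ⟪v i, x⟫_ℂ, memℓp_gen' (sum_norm_inner_rpow_le hv x)⟩
      map_add' x y := by
        ext i
        exact inner_add_right _ _ _
      map_smul' c x := by
        ext i
        exact inner_smul_right _ _ _ }
    (√(∑' i, ‖v i‖ ^ 2))
    fun x => lp.norm_le_of_forall_sum_le (by simp) (by positivity) (sum_norm_inner_rpow_le hv x)

theorem analysis_apply (hv : Summable fun i => ‖v i‖ ^ 2) (x : E) (i : ι) :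
    analysis v hv x i = ⟪v i, x⟫_ℂ :=
  rfl

variable (ι) in
/-- The standard orthonormal basis of `ℓ²(ι)`. -/
def stdHilbertBasis : HilbertBasis ι ℂ (lp (fun _ : ι => ℂ) 2) :=
  HilbertBasis.ofRepr (LinearIsometryEquiv.refl ℂ _)

variable [CompleteSpace E]

theorem adjoint_analysis_stdHilbertBasis (hv : Summable fun i => ‖v i‖ ^ 2) (i : ι) :
    adjoint (analysis v hv) (stdHilbertBasis ι i) = v i := by
  refine ext_inner_right ℂ fun x => ?_
  rw [adjoint_inner_left, ← HilbertBasis.repr_apply_apply]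
  exact analysis_apply hv x i

theorem adjoint_analysis_comp_analysis (hv : Summable fun i => ‖v i‖ ^ 2) :
    adjoint (analysis v hv) ∘L analysis v hv =
      ∑' i, InnerProductSpace.rankOne ℂ (v i) (v i) := by
  have summable_rankOne : Summable fun i => InnerProductSpace.rankOne ℂ (v i) (v i) := by
    refine Summable.of_norm ?_
    simpa only [InnerProductSpace.norm_rankOne, ← sq] using hv
  refine ContinuousLinearMap.ext fun x => ext_inner_left ℂ fun y => ?_
  have hasSum_inner : HasSum (fun i => ⟪y, InnerProductSpace.rankOne ℂ (v i) (v i) x⟫_ℂ)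
      ⟪y, (∑' i, InnerProductSpace.rankOne ℂ (v i) (v i)) x⟫_ℂ :=
    (summable_rankOne.hasSum.mapL (ContinuousLinearMap.apply ℂ E x)).mapL (innerSL ℂ y)
  rw [comp_apply, adjoint_inner_right]
  refine HasSum.unique ?_ hasSum_inner
  refine (lp.hasSum_inner (𝕜 := ℂ) (analysis v hv y) (analysis v hv x)).congr_fun fun i => ?_
  rw [analysis_apply, analysis_apply, InnerProductSpace.rankOne_apply, inner_smul_right,
    RCLike.inner_apply, inner_conj_symm]

theorem hsNormSq_adjoint_analysis_ne_top (hv : Summable fun i => ‖v i‖ ^ 2) :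
    hsNormSq (adjoint (analysis v hv)) ≠ ⊤ := by
  rw [hsNormSq_eq_tsum (stdHilbertBasis ι)]
  have h := ENNReal.ofReal_tsum_of_nonneg (fun i => sq_nonneg ‖v i‖) hv
  simp only [ENNReal.ofReal_pow (norm_nonneg _), ofReal_norm] at h
  simp only [adjoint_analysis_stdHilbertBasis, ← h, ne_eq, ENNReal.ofReal_ne_top, not_false_eq_true]

/-- `∑ᵢ vᵢ ⊗ |i⟩` and `∑ᵢ wᵢ ⊗ |i⟩` are purifications of the two ensembles. -/
theorem tsum_re_inner_le_fidelity_tsum_rankOne (hv : Summable fun i => ‖v i‖ ^ 2)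
    (hw : Summable fun i => ‖w i‖ ^ 2) :
    ∑' i, (⟪v i, w i⟫_ℂ).re ≤
      fidelity (∑' i, InnerProductSpace.rankOne ℂ (v i) (v i))
        (∑' i, InnerProductSpace.rankOne ℂ (w i) (w i)) := by
  have h := tsum_re_inner_le_fidelity (stdHilbertBasis ι) _ _
    (hsNormSq_adjoint_analysis_ne_top hv) (hsNormSq_adjoint_analysis_ne_top hw)
  simpa only [adjoint_analysis_stdHilbertBasis, adjoint_adjoint,
    adjoint_analysis_comp_analysis] using h

end Ensembles

/-! ### Kraus families acting on number-diagonal probes -/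

section Overlap

theorem enorm_eq_tsum_enorm_of_hasSum_nonneg {α : Type*} {f : α → ℂ} {z : ℂ} (hf : ∀ a, 0 ≤ f a)
    (h : HasSum f z) : ‖z‖ₑ = ∑' a, ‖f a‖ₑ := by
  have norm_eq_re {w : ℂ} (hw : 0 ≤ w) : ‖w‖ = w.re := by
    rw [← Complex.ofReal_re ‖w‖, Complex.norm_of_nonneg' hw]
  have hasSum_norm : HasSum (fun a => ‖f a‖) ‖z‖ := by
    simp_rw [norm_eq_re (h.nonneg hf), norm_eq_re (hf _)]
    exact h.mapL Complex.reCLM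
  rw [← ofReal_norm, ← hasSum_norm.tsum_eq,
    ENNReal.ofReal_tsum_of_nonneg (fun _ => norm_nonneg _) hasSum_norm.summable]
  simp_rw [ofReal_norm]

variable {H : Type*} [NormedAddCommGroup H] [InnerProductSpace ℂ H] {M : ℕ} (P : NDSProbe H M)

section IdTensor

variable {a a' : (Fin M → ℕ) → (Fin M → ℕ) → ℂ} {T T' : IdlerSignal H M →L[ℂ] IdlerSignal H M}

theorem NDSProbe.hasSum_inner_apply_ket (T : IdlerSignal H M →L[ℂ] IdlerSignal H M)
    (y : IdlerSignal H M) :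
    HasSum (fun n => (√(P.p n) : ℂ) * ⟪T (lp.single 2 n (P.χ n)), y⟫_ℂ) ⟪T P.ket, y⟫_ℂ := by
  have h := ((P.hasSum_ket.mapL T).mapL (innerSL ℂ y)).star
  simpa only [innerSL_apply_apply, map_smul, smul_eq_mul, RCLike.star_def, map_mul,
    Complex.conj_ofReal, inner_conj_symm] using h

theorem IsIdTensor.inner_χ_apply_ket (hT : IsIdTensor H a T) (m n : Fin M → ℕ) :
    ⟪P.χ n, T P.ket m⟫_ℂ = (√(P.p n) : ℂ) * a m n := by
  have expansion := ((P.hasSum_ket.mapL T).mapL (lp.evalCLM ℂ (fun _ => H) 2 m)).mapL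
    (innerSL ℂ (P.χ n))
  have term_eq (k : Fin M → ℕ) : innerSL ℂ (P.χ n) (lp.evalCLM ℂ (fun _ => H) 2 m
      (T (((√(P.p k) : ℝ) : ℂ) • (lp.single 2 k (P.χ k) : IdlerSignal H M)))) =
      (√(P.p k) : ℂ) * (a m k * ⟪P.χ n, P.χ k⟫_ℂ) := by
    rw [map_smul, map_smul, map_smul, smul_eq_mul, ← inner_smul_right, ← hT k (P.χ k) m]
    rfl
  simp_rw [term_eq] at expansion
  refine expansion.unique ?_
  simpa [P.orthonormal.1 n] using
    hasSum_single (f := fun k => (√(P.p k) : ℂ) * (a m k * ⟪P.χ n, P.χ k⟫_ℂ)) n fun k hk => by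
      rw [P.orthonormal.2 hk.symm, mul_zero, mul_zero]

theorem IsIdTensor.hasSum_inner_single_χ (hT : IsIdTensor H a T) (hT' : IsIdTensor H a' T')
    (n : Fin M → ℕ) :
    HasSum (fun m => star (a m n) * ((√(P.p n) : ℂ) * a' m n))
      ⟪T (lp.single 2 n (P.χ n)), T' P.ket⟫_ℂ := by
  refine (lp.hasSum_inner (𝕜 := ℂ) _ _).congr_fun fun m => ?_
  rw [hT n, inner_smul_left, hT'.inner_χ_apply_ket, RCLike.star_def]

variable (hT : IsIdTensor H a T) (hT' : IsIdTensor H a' T') (ha : ∀ m n, 0 ≤ a m n)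
  (ha' : ∀ m n, 0 ≤ a' m n)
include hT hT' ha ha'

theorem IsIdTensor.inner_single_χ_nonneg (n : Fin M → ℕ) :
    0 ≤ ⟪T (lp.single 2 n (P.χ n)), T' P.ket⟫_ℂ :=
  (hT.hasSum_inner_single_χ P hT' n).nonneg fun m =>
    mul_nonneg (star_nonneg_iff.2 (ha m n))
      (mul_nonneg (Complex.zero_le_real.2 (Real.sqrt_nonneg _)) (ha' m n))

theorem IsIdTensor.inner_apply_ket_nonneg : 0 ≤ ⟪T P.ket, T' P.ket⟫_ℂ :=
  (P.hasSum_inner_apply_ket T _).nonneg fun n =>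
    mul_nonneg (Complex.zero_le_real.2 (Real.sqrt_nonneg _))
      (hT.inner_single_χ_nonneg P hT' ha ha' n)

theorem IsIdTensor.enorm_inner_apply_ket :
    ‖⟪T P.ket, T' P.ket⟫_ℂ‖ₑ =
      ∑' n, ENNReal.ofReal (P.p n) * ∑' m, ‖a m n‖ₑ * ‖a' m n‖ₑ := by
  have sqrt_nonneg (n : Fin M → ℕ) : 0 ≤ (√(P.p n) : ℂ) :=
    Complex.zero_le_real.2 (Real.sqrt_nonneg _)
  have enorm_sqrt_mul_self (n : Fin M → ℕ) :
      ‖(√(P.p n) : ℂ)‖ₑ * ‖(√(P.p n) : ℂ)‖ₑ = ENNReal.ofReal (P.p n) := by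
    rw [← enorm_mul, ← Complex.ofReal_mul, Real.mul_self_sqrt (P.p_nonneg n), ← ofReal_norm,
      Complex.norm_of_nonneg (P.p_nonneg n)]
  have enorm_inner_single (n : Fin M → ℕ) : ‖⟪T (lp.single 2 n (P.χ n)), T' P.ket⟫_ℂ‖ₑ =
      ‖(√(P.p n) : ℂ)‖ₑ * ∑' m, ‖a m n‖ₑ * ‖a' m n‖ₑ := by
    rw [enorm_eq_tsum_enorm_of_hasSum_nonneg (fun m => mul_nonneg (star_nonneg_iff.2 (ha m n))
      (mul_nonneg (sqrt_nonneg n) (ha' m n))) (hT.hasSum_inner_single_χ P hT' n),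
      ← ENNReal.tsum_mul_left]
    simp_rw [enorm_mul, RCLike.star_def, RCLike.enorm_conj, mul_left_comm]
  rw [enorm_eq_tsum_enorm_of_hasSum_nonneg (fun n => mul_nonneg (sqrt_nonneg n)
    (hT.inner_single_χ_nonneg P hT' ha ha' n)) (P.hasSum_inner_apply_ket T _)]
  simp_rw [enorm_mul, enorm_inner_single, ← mul_assoc, enorm_sqrt_mul_self]

end IdTensor

/-- The overlap `⟨V n, V' n⟩` of the Stinespring vectors `V n = ∑ᵢ ∑ₘ K i m n |m⟩|i⟩` of two Kraus
families, encoded with absolute values so that it makes sense without convergence; this is the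
actual overlap when the matrix entries are nonnegative. -/
def krausOverlap {ι X Y : Type*} (K K' : ι → X → Y → ℂ) (n : Y) : ℝ≥0∞ :=
  ∑' i, ∑' m, ‖K i m n‖ₑ * ‖K' i m n‖ₑ

section Channel

variable {ι : Type*} {K K' : ι → (Fin M → ℕ) → (Fin M → ℕ) → ℂ}

theorem NDSProbe.applyChannel_state [CompleteSpace H]
    (K : ι → (Fin M → ℕ) → (Fin M → ℕ) → ℂ) :
    applyChannel K P.state = ∑' i, InnerProductSpace.rankOne ℂ (idTensorOp H (K i) P.ket)
      (idTensorOp H (K i) P.ket) := by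
  refine tsum_congr fun i => ?_
  rw [NDSProbe.state, InnerProductSpace.rankOne_comp, InnerProductSpace.comp_rankOne,
    adjoint_adjoint]

variable (hK : ∀ i, IsIdTensor H (K i) (idTensorOp H (K i))) (hK_nonneg : ∀ i m n, 0 ≤ K i m n)
  (hK' : ∀ i, IsIdTensor H (K' i) (idTensorOp H (K' i))) (hK'_nonneg : ∀ i m n, 0 ≤ K' i m n)
include hK hK_nonneg

include hK' hK'_nonneg in
theorem NDSProbe.tsum_enorm_inner_idTensorOp_ket :
    ∑' i, ‖⟪idTensorOp H (K i) P.ket, idTensorOp H (K' i) P.ket⟫_ℂ‖ₑ =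
      ∑' n, ENNReal.ofReal (P.p n) * krausOverlap K K' n := by
  simp_rw [fun i => (hK i).enorm_inner_apply_ket P (hK' i) (hK_nonneg i) (hK'_nonneg i)]
  rw [ENNReal.tsum_comm]
  simp_rw [ENNReal.tsum_mul_left, krausOverlap]

theorem NDSProbe.summable_norm_sq_idTensorOp_ket (hK_le : ∀ n, krausOverlap K K n ≤ 1) :
    Summable fun i => ‖idTensorOp H (K i) P.ket‖ ^ 2 := by
  have tsum_le : ∑' i, ‖⟪idTensorOp H (K i) P.ket, idTensorOp H (K i) P.ket⟫_ℂ‖ₑ ≤ 1 :=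
    calc _ = ∑' n, ENNReal.ofReal (P.p n) * krausOverlap K K n :=
          P.tsum_enorm_inner_idTensorOp_ket hK hK_nonneg hK hK_nonneg
      _ ≤ ∑' n, ENNReal.ofReal (P.p n) :=
          ENNReal.tsum_le_tsum fun n => mul_le_of_le_one_right' (hK_le n)
      _ = 1 := by
          rw [← ENNReal.ofReal_tsum_of_nonneg P.p_nonneg P.p_hasSum.summable,
            P.p_hasSum.tsum_eq, ENNReal.ofReal_one]
  refine (tsum_enorm_ne_top_iff_summable_norm.1
    (ne_top_of_le_ne_top ENNReal.one_ne_top tsum_le)).congr fun i => ?_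
  rw [inner_self_eq_norm_sq_to_K]
  simp

include hK' hK'_nonneg in
theorem NDSProbe.toReal_tsum_krausOverlap_le_fidelity [CompleteSpace H]
    (hK_le : ∀ n, krausOverlap K K n ≤ 1) (hK'_le : ∀ n, krausOverlap K' K' n ≤ 1) :
    (∑' n, ENNReal.ofReal (P.p n) * krausOverlap K K' n).toReal ≤
      fidelity (applyChannel K P.state) (applyChannel K' P.state) := by
  rw [P.applyChannel_state, P.applyChannel_state,
    ← P.tsum_enorm_inner_idTensorOp_ket hK hK_nonneg hK' hK'_nonneg,
    ENNReal.tsum_toReal_eq fun _ => enorm_ne_top]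
  refine (tsum_congr fun i => ?_).trans_le (tsum_re_inner_le_fidelity_tsum_rankOne
    (P.summable_norm_sq_idTensorOp_ket hK hK_nonneg hK_le)
    (P.summable_norm_sq_idTensorOp_ket hK' hK'_nonneg hK'_le))
  rw [toReal_enorm, ← Complex.ofReal_re ‖_‖, Complex.norm_of_nonneg'
    ((hK i).inner_apply_ket_nonneg P (hK' i) (hK_nonneg i) (hK'_nonneg i))]

end Channel

theorem NDSProbe.tsum_p_mul_comp_sum (g : ℕ → ℝ≥0∞) :
    ∑' n, ENNReal.ofReal (P.p n) * g (∑ s, n s) =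
      ∑' N, ENNReal.ofReal (P.totalPMF N) * g N := by
  rw [← ENNReal.tsum_fiberwise _ fun n : Fin M → ℕ => ∑ s, n s]
  refine tsum_congr fun N => ?_
  have fiber_eq : (fun n : Fin M → ℕ => ∑ s, n s) ⁻¹' {N} =
      (Finset.piAntidiag Finset.univ N : Finset (Fin M → ℕ)) := by
    ext n
    simp
  rw [fiber_eq, Finset.tsum_subtype' _ fun n => ENNReal.ofReal (P.p n) * g (∑ s, n s),
    totalPMF, ENNReal.ofReal_sum_of_nonneg fun n _ => P.p_nonneg n, Finset.sum_mul]
  refine Finset.sum_congr rfl fun n hn => ?_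
  rw [(Finset.mem_piAntidiag.1 hn).1]

end Overlap

/-! ### Loss followed by amplification -/

section Cascade

theorem enorm_ofReal_mul_enorm_ofReal {x y : ℝ} (hx : 0 ≤ x) (hy : 0 ≤ y) :
    ‖(x : ℂ)‖ₑ * ‖(y : ℂ)‖ₑ = ENNReal.ofReal (x * y) := by
  rw [← ofReal_norm, ← ofReal_norm, Complex.norm_of_nonneg hx, Complex.norm_of_nonneg hy,
    ENNReal.ofReal_mul hx]

theorem tsum_pi_prod {M : ℕ} {ι : Fin M → Type*} (f : ∀ s, ι s → ℝ≥0∞) :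
    ∑' i : ∀ s, ι s, ∏ s, f s (i s) = ∏ s, ∑' i, f s i := by
  induction M with
  | zero => simp
  | succ M ih =>
    rw [← (Fin.consEquiv ι).tsum_eq, ENNReal.tsum_prod', Fin.prod_univ_succ,
      ← ih, ← ENNReal.tsum_mul_right]
    simp_rw [← ENNReal.tsum_mul_left]
    refine tsum_congr fun i₀ => tsum_congr fun i => ?_
    simp [Fin.consEquiv, Fin.prod_univ_succ]

variable {G G' κ κ' : ℝ}

theorem sqrt_sub_one_mul_sub_one_lt_sqrt_mul (hG : 1 ≤ G) (hG' : 1 ≤ G') :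
    √((G - 1) * (G' - 1)) < √(G * G') :=
  Real.sqrt_lt_sqrt (mul_nonneg (sub_nonneg.2 hG) (sub_nonneg.2 hG')) (by nlinarith)

theorem nu_pos (hG : 1 ≤ G) (hG' : 1 ≤ G') : 0 < nu G G' :=
  inv_pos.2 (sub_pos.2 (sqrt_sub_one_mul_sub_one_lt_sqrt_mul hG hG'))

theorem nu_self (hG : 1 ≤ G) : nu G G = 1 := by
  rw [nu, Real.sqrt_mul_self (by linarith), Real.sqrt_mul_self (by linarith), sub_sub_cancel,
    inv_one]

theorem ampKraus_nonneg (hG : 1 ≤ G) (k m r : ℕ) : 0 ≤ ampKraus G k m r := by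
  rw [ampKraus_eq hG]
  split_ifs
  · exact Complex.zero_le_real.2 (by positivity)
  · exact le_rfl

theorem lossKraus_nonneg (κ : ℝ) (l m n : ℕ) : 0 ≤ lossKraus κ l m n := by
  rw [lossKraus_eq]
  split_ifs
  · exact Complex.zero_le_real.2 (by positivity)
  · exact le_rfl

theorem cascadeKraus_nonneg (hG : 1 ≤ G) (κ : ℝ) {M : ℕ} (i : Fin M → ℕ × ℕ) (m n : Fin M → ℕ) :
    0 ≤ cascadeKraus G κ M i m n := by
  change 0 ≤ ∏ s, compKraus (ampKraus G) (lossKraus κ) (i s) (m s) (n s)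
  refine Finset.prod_nonneg fun s _ => ?_
  rw [compKraus_eq]
  exact mul_nonneg (ampKraus_nonneg hG _ _ _) (lossKraus_nonneg κ _ _ _)

theorem tsum_enorm_ampKraus_mul_enorm_ampKraus (hG : 1 ≤ G) (hG' : 1 ≤ G') (k r : ℕ) :
    ∑' m, ‖ampKraus G k m r‖ₑ * ‖ampKraus G' k m r‖ₑ =
      ENNReal.ofReal ((√(G * G'))⁻¹ ^ (r + 1) *
        (((k + r).choose r : ℝ) * (√((G - 1) * (G' - 1)) / √(G * G')) ^ k)) := by
  have hG0 : 0 ≤ G := zero_le_one.trans hG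
  rw [tsum_eq_single (r + k) fun m hm => by rw [ampKraus_eq hG, if_neg hm, enorm_zero, zero_mul],
    ampKraus_eq hG, ampKraus_eq hG', if_pos rfl, if_pos rfl,
    enorm_ofReal_mul_enorm_ofReal (by positivity) (by positivity), add_comm k r,
    Nat.choose_symm_add, ← Real.sqrt_div (mul_nonneg (sub_nonneg.2 hG) (sub_nonneg.2 hG')),
    mul_div_mul_comm, Real.sqrt_mul (div_nonneg (sub_nonneg.2 hG) hG0), Real.sqrt_mul hG0]
  nth_rw 3 [← Real.mul_self_sqrt (Nat.cast_nonneg ((r + k).choose k))]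
  congr 1
  ring

theorem krausOverlap_ampKraus (hG : 1 ≤ G) (hG' : 1 ≤ G') (r : ℕ) :
    krausOverlap (ampKraus G) (ampKraus G') r = ENNReal.ofReal (nu G G' ^ (r + 1)) := by
  have sqrt_lt := sqrt_sub_one_mul_sub_one_lt_sqrt_mul hG hG'
  have sqrt_pos : 0 < √(G * G') := (Real.sqrt_nonneg _).trans_lt sqrt_lt
  set x := √((G - 1) * (G' - 1)) / √(G * G') with hx
  have hx_lt : ‖x‖ < 1 := by
    rwa [Real.norm_of_nonneg (by positivity), div_lt_one sqrt_pos]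
  have negative_binomial := (hasSum_choose_mul_geometric_of_norm_lt_one r hx_lt).mul_left
    ((√(G * G'))⁻¹ ^ (r + 1))
  rw [krausOverlap, tsum_congr fun k => tsum_enorm_ampKraus_mul_enorm_ampKraus hG hG' k r,
    ← ENNReal.ofReal_tsum_of_nonneg (fun k => by positivity) negative_binomial.summable,
    negative_binomial.tsum_eq, one_div, ← inv_pow, ← mul_pow, ← mul_inv, nu, mul_sub, mul_one,
    hx, mul_div_cancel₀ _ sqrt_pos.ne']

theorem enorm_lossKraus_mul_enorm_lossKraus (hκ : κ ∈ Set.Icc (0 : ℝ) 1) {l n : ℕ} (hl : l ≤ n) :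
    ‖lossKraus κ l (n - l) n‖ₑ * ‖lossKraus κ' l (n - l) n‖ₑ =
      ENNReal.ofReal (√((1 - κ) * (1 - κ')) ^ l * √(κ * κ') ^ (n - l) * (n.choose l : ℝ)) := by
  have hn : n = n - l + l := (Nat.sub_add_cancel hl).symm
  rw [lossKraus_eq, lossKraus_eq, if_pos hn, if_pos hn, ← hn,
    enorm_ofReal_mul_enorm_ofReal (by positivity) (by positivity), Real.sqrt_mul hκ.1,
    Real.sqrt_mul (sub_nonneg.2 hκ.2)]
  nth_rw 3 [← Real.mul_self_sqrt (Nat.cast_nonneg (n.choose l))]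
  congr 1
  ring

theorem krausOverlap_compKraus_ampKraus_lossKraus (n : ℕ) :
    krausOverlap (compKraus (ampKraus G) (lossKraus κ)) (compKraus (ampKraus G') (lossKraus κ')) n =
      ∑ l ∈ Finset.range (n + 1), ‖lossKraus κ l (n - l) n‖ₑ * ‖lossKraus κ' l (n - l) n‖ₑ *
        krausOverlap (ampKraus G) (ampKraus G') (n - l) := by
  have factor (l : ℕ) : ∑' k, ∑' m, ‖ampKraus G k m (n - l)‖ₑ * ‖lossKraus κ l (n - l) n‖ₑ *
      (‖ampKraus G' k m (n - l)‖ₑ * ‖lossKraus κ' l (n - l) n‖ₑ) =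
      ‖lossKraus κ l (n - l) n‖ₑ * ‖lossKraus κ' l (n - l) n‖ₑ *
        krausOverlap (ampKraus G) (ampKraus G') (n - l) := by
    simp_rw [krausOverlap, ← ENNReal.tsum_mul_left]
    refine tsum_congr fun k => tsum_congr fun m => ?_
    ring
  simp_rw [krausOverlap.eq_def (compKraus _ _), compKraus_eq, enorm_mul]
  rw [ENNReal.tsum_prod', ENNReal.tsum_comm]
  simp_rw [factor]
  refine tsum_eq_sum fun l hl => ?_
  rw [lossKraus_eq, if_neg (by have := Finset.mem_range.not.1 hl; omega), enorm_zero, zero_mul,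
    zero_mul]

theorem krausOverlap_compKraus_ampKraus_lossKraus_eq_ofReal (hG : 1 ≤ G) (hG' : 1 ≤ G')
    (hκ : κ ∈ Set.Icc (0 : ℝ) 1) (n : ℕ) :
    krausOverlap (compKraus (ampKraus G) (lossKraus κ)) (compKraus (ampKraus G') (lossKraus κ')) n =
      ENNReal.ofReal (nu G G' * (nu G G' * √(κ * κ') + √((1 - κ) * (1 - κ'))) ^ n) := by
  have hν := (nu_pos hG hG').le
  have term_eq (l : ℕ) (hl : l ∈ Finset.range (n + 1)) :
      ‖lossKraus κ l (n - l) n‖ₑ * ‖lossKraus κ' l (n - l) n‖ₑ *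
        krausOverlap (ampKraus G) (ampKraus G') (n - l) =
      ENNReal.ofReal (nu G G' * (√((1 - κ) * (1 - κ')) ^ l *
        (nu G G' * √(κ * κ')) ^ (n - l) * (n.choose l : ℝ))) := by
    rw [enorm_lossKraus_mul_enorm_lossKraus hκ (Finset.mem_range_succ_iff.1 hl),
      krausOverlap_ampKraus hG hG', ← ENNReal.ofReal_mul (by positivity)]
    congr 1
    ring
  rw [krausOverlap_compKraus_ampKraus_lossKraus, Finset.sum_congr rfl term_eq,
    ← ENNReal.ofReal_sum_of_nonneg fun l _ => by positivity, ← Finset.mul_sum, ← add_pow,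
    add_comm √((1 - κ) * (1 - κ'))]

theorem krausOverlap_tensorKraus {ι : Type*} {M : ℕ} (K K' : ι → ℕ → ℕ → ℂ) (n : Fin M → ℕ) :
    krausOverlap (tensorKraus K M) (tensorKraus K' M) n = ∏ s, krausOverlap K K' (n s) := by
  have enorm_tensorKraus (K : ι → ℕ → ℕ → ℂ) (i : Fin M → ι) (m : Fin M → ℕ) :
      ‖tensorKraus K M i m n‖ₑ = ∏ s, ‖K (i s) (m s) (n s)‖ₑ := by
    simp only [tensorKraus, ← ofReal_norm, norm_prod]
    exact ENNReal.ofReal_prod_of_nonneg fun _ _ => norm_nonneg _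
  simp_rw [krausOverlap, enorm_tensorKraus, ← Finset.prod_mul_distrib]
  rw [← tsum_pi_prod fun s i => ∑' m, ‖K i m (n s)‖ₑ * ‖K' i m (n s)‖ₑ]
  exact tsum_congr fun i => tsum_pi_prod fun s m => ‖K (i s) m (n s)‖ₑ * ‖K' (i s) m (n s)‖ₑ

theorem krausOverlap_cascadeKraus (hG : 1 ≤ G) (hG' : 1 ≤ G') (hκ : κ ∈ Set.Icc (0 : ℝ) 1)
    (κ' : ℝ) {M : ℕ} (n : Fin M → ℕ) :
    krausOverlap (cascadeKraus G κ M) (cascadeKraus G' κ' M) n =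
      ENNReal.ofReal (nu G G' ^ M *
        (nu G G' * √(κ * κ') + √((1 - κ) * (1 - κ'))) ^ ∑ s, n s) := by
  have hν := (nu_pos hG hG').le
  simp_rw [cascadeKraus, krausOverlap_tensorKraus,
    krausOverlap_compKraus_ampKraus_lossKraus_eq_ofReal hG hG' hκ]
  rw [← ENNReal.ofReal_prod_of_nonneg fun s _ => by positivity, Finset.prod_mul_distrib,
    Finset.prod_pow_eq_pow_sum, Fin.prod_const]

theorem krausOverlap_cascadeKraus_self (hG : 1 ≤ G) (hκ : κ ∈ Set.Icc (0 : ℝ) 1) {M : ℕ}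
    (n : Fin M → ℕ) : krausOverlap (cascadeKraus G κ M) (cascadeKraus G κ M) n = 1 := by
  rw [krausOverlap_cascadeKraus hG hG hκ, nu_self hG, Real.sqrt_mul_self hκ.1,
    Real.sqrt_mul_self (sub_nonneg.2 hκ.2), one_mul, add_sub_cancel, one_pow, one_pow, one_mul,
    ENNReal.ofReal_one]

theorem NDSProbe.toReal_tsum_krausOverlap_cascadeKraus {H : Type*} [NormedAddCommGroup H]
    [InnerProductSpace ℂ H] {M : ℕ} (P : NDSProbe H M) (hG : 1 ≤ G) (hG' : 1 ≤ G')
    (hκ : κ ∈ Set.Icc (0 : ℝ) 1) (κ' : ℝ) :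
    (∑' n, ENNReal.ofReal (P.p n) *
        krausOverlap (cascadeKraus G κ M) (cascadeKraus G' κ' M) n).toReal =
      nu G G' ^ M * ∑' n, P.totalPMF n *
        (nu G G' * √(κ * κ') + √((1 - κ) * (1 - κ'))) ^ n := by
  have hν := (nu_pos hG hG').le
  simp_rw [krausOverlap_cascadeKraus hG hG' hκ]
  rw [P.tsum_p_mul_comp_sum fun N => ENNReal.ofReal (nu G G' ^ M *
      (nu G G' * √(κ * κ') + √((1 - κ) * (1 - κ'))) ^ N),
    ENNReal.tsum_toReal_eq fun _ => by finiteness, ← tsum_mul_left]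
  refine tsum_congr fun N => ?_
  have totalPMF_nonneg : 0 ≤ P.totalPMF N := Finset.sum_nonneg fun n _ => P.p_nonneg n
  rw [ENNReal.toReal_mul, ENNReal.toReal_ofReal totalPMF_nonneg,
    ENNReal.toReal_ofReal (by positivity), mul_left_comm]

end Cascade

end Bosonic

end

theorem mainTheorem2 {H : Type*} [NormedAddCommGroup H] [InnerProductSpace ℂ H] [CompleteSpace H]
    (M : ℕ) (G G' κ κ' : ℝ) (hG : 1 ≤ G) (hG' : 1 ≤ G')
    (hκ : κ ∈ Set.Icc (0 : ℝ) 1) (hκ' : κ' ∈ Set.Icc (0 : ℝ) 1)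
    (P : Bosonic.NDSProbe H M) :
    Bosonic.nu G G' ^ M *
        ∑' n : ℕ, P.totalPMF n *
          (Bosonic.nu G G' * √(κ * κ') + √((1 - κ) * (1 - κ'))) ^ n ≤
      Bosonic.fidelity
        (Bosonic.applyChannel (Bosonic.cascadeKraus G κ M) P.state)
        (Bosonic.applyChannel (Bosonic.cascadeKraus G' κ' M) P.state) := by
  rw [← P.toReal_tsum_krausOverlap_cascadeKraus hG hG' hκ κ']
  exact P.toReal_tsum_krausOverlap_le_fidelity
    (Bosonic.isIdTensor_cascade H hG hκ M) (Bosonic.cascadeKraus_nonneg hG κ)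
    (Bosonic.isIdTensor_cascade H hG' hκ' M) (Bosonic.cascadeKraus_nonneg hG' κ')
    (fun n => (Bosonic.krausOverlap_cascadeKraus_self hG hκ n).le)
    (fun n => (Bosonic.krausOverlap_cascadeKraus_self hG' hκ' n).le)
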